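/- Consider the coded caching problem with $N$ files of $F$ bits each and $K$ users. In the caching phase, before the requests are known, each user stores at most $c$ bits, computed from the $N$ files. In the delivery phase user $k$ requests file $d_k\in\{1,\dots,N\}$, and the server broadcasts to all users a common message of at most $r$ bits, computed from the files and from $(d_1,\dots,d_K)$. For all files and all demand vectors $(d_1,\dots,d_K)$, every user $k$ must recover file $d_k$ from the message, its own cache content and $(d_1,\dots,d_K)$. The pair $(M,R)$ is \emph{achievable} if for every $\varepsilon>0$ and every sufficiently large $F$ there is such a scheme with $c\le (M+\varepsilon)F$ and $r\le (R+\varepsilon)F$. Let $1\le N\le K$ be integers. Let $\mathcal P_1$ be the set of points $$\left(\frac{t[(N-1)t+K-N]}{K(K-1)},\ \frac{N(K-t)}{K}\right),\qquad t=0,1,\dots,K,$$ where for $K=1$, when the formula reads $0/0$, we put $\mathcal P_1=\emptyset$. Let $\mathcal P_2$ be the set of points $$\left(M,\ K\Bigl(1-\frac MN\Bigr)\min\left\{\frac{1}{1+KM/N},\ \frac NK\right\}\right),\qquad M\in\Bigl\{0,\frac NK,\frac{2N}K,\dots,N\Bigr\}.$$ For every real $M$ with $0\le M\le N$, let $R^*(M)$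 be the value at $M$ of the lower convex envelope of $\mathcal P_1\cup\mathcal P_2$, that is, the smallest $R$ for which $(M,R)$ lies in the convex hull of $\mathcal P_1\cup\mathcal P_2$. Then this minimum exists, and the pair $(M,R^*(M))$ is achievable for $N$ files and $K$ users. -/

import Mathlib

/-- A file (or cache content, or broadcast message) of `F` bits. -/
abbrev Bits (F : ℕ) : Type := Fin F → Bool

/-- A library of `N` files of `F` bits each. -/
abbrev Library (N F : ℕ) : Type := Fin N → Bits F

/-- A caching scheme for `N` files of `F` bits each and `K` users, with `c` bits of cache memory per
user and a common broadcast message of `r` bits.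

In the caching phase, user `k` stores a function of the library; the demands are not known then.
In the delivery phase, user `k` requests file `d k`, and the server broadcasts one message, a
function of the library and of the demand vector `d`. From this message, its own cache content
and `d`, every user must recover the file it requested, for every library and every demand. -/
structure CachingScheme (N K F c r : ℕ) where
  /-- the content placed in the cache of each user -/
  place : Fin K → Library N F → Bits c
  /-- the message broadcast for a demand vector -/
  deliver : (Fin K → Fin N) → Library N F → Bits r
  /-- the decoder of each user, for each demand vector -/
  decode : Fin K → (Fin K → Fin N) → Bits r → Bits c → Bits F
  /-- every user recovers the file it requested -/
  correct : ∀ (W : Library N F) (d : Fin K → Fin N) (k : Fin K),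
    decode k d (deliver d W) (place k W) = W (d k)

/-- The memory-rate pair `(M, R)`, measured in multiples of the file size, is achievable for `N`
files and `K` users: for every `ε > 0` and every large enough file size `F` there is a caching
scheme with at most `(M + ε) F` bits of cache per user and at most `(R + ε) F` broadcast bits. -/
def Achievable (N K : ℕ) (M R : ℝ) : Prop :=
  ∀ ε : ℝ, 0 < ε → ∃ F₀ : ℕ, ∀ F : ℕ, F₀ ≤ F →
    ∃ c r : ℕ, (c : ℝ) ≤ (M + ε) * F ∧ (r : ℝ) ≤ (R + ε) * F ∧
      Nonempty (CachingScheme N K F c r)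

/-- The points `(t[(N-1)t + K - N] / (K(K-1)), N(K-t)/K)` for `t = 0, 1, …, K`. The formula needs
`K ≥ 2`; for `K = 1` it reads `0/0`, and the set is empty. -/
def interferenceEliminationPoints (N K : ℕ) : Set (ℝ × ℝ) :=
  {p | 2 ≤ K ∧ ∃ t : ℕ, t ≤ K ∧
    p.1 = (t : ℝ) * (((N : ℝ) - 1) * t + K - N) / ((K : ℝ) * ((K : ℝ) - 1)) ∧
    p.2 = (N : ℝ) * ((K : ℝ) - t) / K}

/-- The points `(M, K (1 - M/N) min {1/(1 + K M/N), N/K})` for `M = 0, N/K, 2N/K, …, N`. -/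
def maddahAliNiesenPoints (N K : ℕ) : Set (ℝ × ℝ) :=
  {p | (∃ t : ℕ, t ≤ K ∧ p.1 = (t : ℝ) * N / K) ∧
    p.2 = (K : ℝ) * (1 - p.1 / N) * min (1 / (1 + K * p.1 / N)) ((N : ℝ) / K)}

/-- The lower convex envelope at `M` of a set `P` of points of the plane: the smallest second
coordinate of a point of the convex hull of `P` that has first coordinate `M`. -/
noncomputable def lowerConvexEnvelope (P : Set (ℝ × ℝ)) (M : ℝ) : ℝ :=
  sInf {R : ℝ | (M, R) ∈ convexHull ℝ P}

/-!
A finite set has a compact convex hull, so the lower convex envelope is attained; and the achievable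
pairs form a convex set by memory sharing (`convex_achievable`), so it suffices to achieve the
points of the two families.

Both come from linear schemes (`achievable_of_linear`): file symbols are the values of a linear form
at independent vectors of a space `V` over a field with `2 ^ m` elements, and caches and messages are
the values of that form on subspaces of `V`. A single scheme for one file size is enough, since it can
be applied to consecutive blocks. The Maddah-Ali–Niesen points are the classical scheme
(`achievable_maddahAliNiesen`) and uncoded caching.

For the interference elimination points with `t = s + 1`, the `K.choose t` subfiles of a file are the
exterior products `e_S`, `|S| = t`, of the standard basis of `F ^ K`, and `V` consists of `N` copies of
the exterior algebra. User `k` stores only combinations of the subfiles `(n, S)` with `k ∈ S`; they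
span a space `E k`, which is `e k ∧ ⋀^s` in every copy. If the users with demand `n` form the set `I`,
broadcasting for file `n` the subspace `⋀^t H`, with `H` the hyperplane annihilated by the indicator of
`I`, serves both kinds of users: for `k ∈ I`, the rest of the file is determined by the symbols in
`E k`; for `k ∉ I`, the space `⋀^t H` contains `e k ∧ ⋀^s H`, that is, forms in symbols of `E k` alone,
so that the interference of file `n` can be eliminated. All the hyperplanes are coordinate hyperplanes
in one basis, obtained by choosing a leader for each file and subtracting from every other basis
vector the one of its leader.

If some files are not requested, other users are appointed as their leaders, so that one requested
file has several hyperplanes. Then the subspaces for this file overlap, and the dimensions gained are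
spent on the unrequested files; which copies receive which basis products is decided by the monotone
choice of `exists_monotone_card_eq_of_idempotent`. For every demand vector the broadcast then meets
`E k` in dimension at least `(N - 1) (K - 2).choose s` (`exists_delivery_subspace`). There are finitely
many demand vectors, so over a large field one subspace of `E k` of the complementary dimension
completes all these intersections to `E k` (`Submodule.exists_finrank_le_forall_le_sup`); user `k`
caches it.
-/

/-! ### Combining caching schemes -/

/-- A placement and a delivery suffice for a caching scheme as soon as the cache content and the
message together determine the requested file: the decoder is then a choice of preimage. -/
theorem CachingScheme.nonempty_of_determines {N K F c r : ℕ} (place : Fin K → Library N F → Bits c)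
    (deliver : (Fin K → Fin N) → Library N F → Bits r)
    (h : ∀ W W' d k, place k W = place k W' → deliver d W = deliver d W' → W (d k) = W' (d k)) :
    Nonempty (CachingScheme N K F c r) := by
  classical
  refine ⟨⟨place, deliver, fun k d m z =>
    if h : ∃ W, deliver d W = m ∧ place k W = z then h.choose (d k) else fun _ => false, ?_⟩⟩
  intro W d k
  have hW : ∃ W', deliver d W' = deliver d W ∧ place k W' = place k W := ⟨W, rfl, rfl⟩
  rw [dif_pos hW]
  exact h _ _ _ _ hW.choose_spec.2 hW.choose_spec.1

/-- Two schemes applied to the two parts of every file. -/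
def CachingScheme.append {N K F₁ c₁ r₁ F₂ c₂ r₂ : ℕ} (s₁ : CachingScheme N K F₁ c₁ r₁)
    (s₂ : CachingScheme N K F₂ c₂ r₂) :
    CachingScheme N K (F₁ + F₂) (c₁ + c₂) (r₁ + r₂) where
  place k W := Fin.append (s₁.place k fun n i => W n (Fin.castAdd F₂ i))
    (s₂.place k fun n i => W n (Fin.natAdd F₁ i))
  deliver d W := Fin.append (s₁.deliver d fun n i => W n (Fin.castAdd F₂ i))
    (s₂.deliver d fun n i => W n (Fin.natAdd F₁ i))
  decode k d m z := Fin.append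
    (s₁.decode k d (fun i => m (Fin.castAdd r₂ i)) (fun i => z (Fin.castAdd c₂ i)))
    (s₂.decode k d (fun i => m (Fin.natAdd r₁ i)) (fun i => z (Fin.natAdd c₁ i)))
  correct W d k := by
    funext i
    refine Fin.addCases (fun i => ?_) (fun i => ?_) i
    · simp [s₁.correct]
    · simp [s₂.correct]

/-- A scheme for longer files serves shorter files, padded with zero bits. -/
def CachingScheme.shorten {N K F F' c r : ℕ} (s : CachingScheme N K F c r) (h : F' ≤ F) :
    CachingScheme N K F' c r where
  place k W := s.place k fun n i => if hi : (i : ℕ) < F' then W n ⟨i, hi⟩ else false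
  deliver d W := s.deliver d fun n i => if hi : (i : ℕ) < F' then W n ⟨i, hi⟩ else false
  decode k d m z := fun i => s.decode k d m z (Fin.castLE h i)
  correct W d k := by
    funext i
    simp [s.correct]

theorem CachingScheme.nonempty_mul {N K F c r : ℕ} (s : CachingScheme N K F c r) (L : ℕ) :
    Nonempty (CachingScheme N K (L * F) (L * c) (L * r)) := by
  induction L with
  | zero =>
    refine CachingScheme.nonempty_of_determines (fun _ _ _ => false) (fun _ _ _ => false) ?_
    intro W W' d k _ _
    funext i
    exact absurd i.2 (by simp)
  | succ L ih =>
    obtain ⟨s'⟩ := ih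
    simp only [Nat.succ_mul]
    exact ⟨s'.append s⟩

/-- One scheme for one positive file size makes its normalized cache size and rate achievable: apply
it to consecutive blocks of the files, the last of them padded. -/
theorem CachingScheme.achievable {N K F c r : ℕ} (s : CachingScheme N K F c r) (hF : 0 < F) :
    Achievable N K ((c : ℝ) / F) ((r : ℝ) / F) := by
  intro ε hε
  obtain ⟨F₀, hF₀⟩ := exists_nat_ge (((c : ℝ) + r) / ε)
  refine ⟨F₀, fun G hG => ?_⟩
  obtain ⟨s'⟩ := s.nonempty_mul (G / F + 1)
  have hFR : (0 : ℝ) < F := by exact_mod_cast hF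
  have hGε : (c : ℝ) + r ≤ ε * G := by
    have : ((c : ℝ) + r) / ε ≤ G := hF₀.trans (by exact_mod_cast hG)
    rw [div_le_iff₀ hε] at this
    linarith
  have hdiv : ((G / F : ℕ) : ℝ) ≤ (G : ℝ) / F := Nat.cast_div_le
  have key : ∀ x : ℕ, (x : ℝ) ≤ ε * G →
      (((G / F + 1) * x : ℕ) : ℝ) ≤ ((x : ℝ) / F + ε) * G := by
    intro x hx
    push_cast
    have h1 := mul_le_mul_of_nonneg_right hdiv (Nat.cast_nonneg (α := ℝ) x)
    have h2 : (x : ℝ) / F * G = (G : ℝ) / F * x := by ring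
    rw [add_mul, add_mul, one_mul, h2]
    linarith
  have hc : (0 : ℝ) ≤ c := Nat.cast_nonneg c
  have hr : (0 : ℝ) ≤ r := Nat.cast_nonneg r
  refine ⟨_, _, key c (by linarith), key r (by linarith), ⟨s'.shorten ?_⟩⟩
  have := Nat.lt_div_mul_add (a := G) hF
  rw [Nat.add_mul, one_mul]
  exact this.le

/-- Memory sharing: the achievable pairs form a convex set. -/
theorem convex_achievable (N K : ℕ) : Convex ℝ {p : ℝ × ℝ | Achievable N K p.1 p.2} := by
  rintro ⟨M₁, R₁⟩ h₁ ⟨M₂, R₂⟩ h₂ a b ha hb hab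
  simp only [Set.mem_ofPred_eq, Prod.smul_mk, Prod.mk_add_mk, smul_eq_mul] at h₁ h₂ ⊢
  rcases ha.eq_or_lt with rfl | ha
  · obtain rfl : b = 1 := by linarith
    simpa using h₂
  rcases hb.eq_or_lt with rfl | hb
  · obtain rfl : a = 1 := by linarith
    simpa using h₁
  intro ε hε
  obtain ⟨F₁, hF₁⟩ := h₁ (ε / 2) (by positivity)
  obtain ⟨F₂, hF₂⟩ := h₂ (ε / 2) (by positivity)
  obtain ⟨G₁, hG₁⟩ := exists_nat_ge (((F₁ : ℝ) + 1) / a)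
  obtain ⟨G₂, hG₂⟩ := exists_nat_ge ((F₂ : ℝ) / b)
  obtain ⟨G₃, hG₃⟩ := exists_nat_ge ((|M₁| + |M₂| + |R₁| + |R₂|) / (ε / 2))
  refine ⟨max G₁ (max G₂ G₃), fun F hF => ?_⟩
  have hG1 : (G₁ : ℝ) ≤ F := by exact_mod_cast (le_max_left _ _).trans hF
  have hG2 : (G₂ : ℝ) ≤ F := by
    exact_mod_cast ((le_max_left _ _).trans (le_max_right _ _)).trans hF
  have hG3 : (G₃ : ℝ) ≤ F := by
    exact_mod_cast ((le_max_right _ _).trans (le_max_right _ _)).trans hF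
  have e1 : (F₁ : ℝ) + 1 ≤ a * F := by
    have := hG₁.trans hG1
    rw [div_le_iff₀ ha] at this
    linarith
  have e2 : (F₂ : ℝ) ≤ b * F := by
    have := hG₂.trans hG2
    rw [div_le_iff₀ hb] at this
    linarith
  have e3 : |M₁| + |M₂| + |R₁| + |R₂| ≤ ε / 2 * F := by
    have := hG₃.trans hG3
    rw [div_le_iff₀ (by positivity)] at this
    linarith
  have haF : 0 ≤ a * (F : ℝ) := by positivity
  have f1 : ((⌊a * F⌋₊ : ℕ) : ℝ) ≤ a * F := Nat.floor_le haF
  have f2 : a * F < (⌊a * F⌋₊ : ℕ) + 1 := Nat.lt_floor_add_one _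
  generalize ⌊a * F⌋₊ = A at f1 f2
  have hAF : A ≤ F := by
    have : (A : ℝ) ≤ F := f1.trans (mul_le_of_le_one_left (Nat.cast_nonneg F) (by linarith))
    exact_mod_cast this
  obtain ⟨B, rfl⟩ := Nat.exists_eq_add_of_le hAF
  have hsplit : a * ((A + B : ℕ) : ℝ) + b * ((A + B : ℕ) : ℝ) = A + B := by
    rw [← add_mul, hab]; push_cast; ring
  obtain ⟨c₁, r₁, hc₁, hr₁, ⟨s₁⟩⟩ := hF₁ A (by
    have : (F₁ : ℝ) ≤ A := by linarith
    exact_mod_cast this)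
  obtain ⟨c₂, r₂, hc₂, hr₂, ⟨s₂⟩⟩ := hF₂ B (by
    have : (F₂ : ℝ) ≤ B := by linarith
    exact_mod_cast this)
  -- rounding `a F` down to `A` costs at most `|x| + |y|` bits
  have key : ∀ x y : ℝ, |x| + |y| ≤ ε / 2 * ((A + B : ℕ) : ℝ) →
      (x + ε / 2) * A + (y + ε / 2) * B ≤ (a * x + b * y + ε) * ((A + B : ℕ) : ℝ) := by
    intro x y hxy
    set δ : ℝ := a * ((A + B : ℕ) : ℝ) - A with hδ
    have hδ0 : 0 ≤ δ := by linarith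
    have hδ1 : δ ≤ 1 := by linarith
    have hb' : b * ((A + B : ℕ) : ℝ) = B - δ := by linarith
    have ha' : a * ((A + B : ℕ) : ℝ) = A + δ := by linarith
    have hx : -x * δ ≤ |x| := by
      calc -x * δ ≤ |x| * δ := mul_le_mul_of_nonneg_right (neg_le_abs x) hδ0
        _ ≤ |x| := mul_le_of_le_one_right (abs_nonneg x) hδ1
    have hy : y * δ ≤ |y| := by
      calc y * δ ≤ |y| * δ := mul_le_mul_of_nonneg_right (le_abs_self y) hδ0
        _ ≤ |y| := mul_le_of_le_one_right (abs_nonneg y) hδ1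
    have : (a * x + b * y + ε) * ((A + B : ℕ) : ℝ)
        = x * (A + δ) + y * (B - δ) + ε / 2 * (A + B) + ε / 2 * ((A + B : ℕ) : ℝ) := by
      rw [← ha', ← hb']; push_cast; ring
    rw [this]
    linarith
  have hM₁ := abs_nonneg M₁
  have hM₂ := abs_nonneg M₂
  have hR₁ := abs_nonneg R₁
  have hR₂ := abs_nonneg R₂
  refine ⟨c₁ + c₂, r₁ + r₂, ?_, ?_, ⟨s₁.append s₂⟩⟩
  · push_cast only [Nat.cast_add c₁ c₂]
    exact (add_le_add hc₁ hc₂).trans (key M₁ M₂ (by linarith))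
  · push_cast only [Nat.cast_add r₁ r₂]
    exact (add_le_add hr₁ hr₂).trans (key R₁ R₂ (by linarith))

/-- Broadcasting all the files, without using the caches. -/
theorem achievable_zero_memory (N K : ℕ) : Achievable N K 0 N := by
  have e : (Fin N → Fin 1 → Bool) ≃ Bits N := Equiv.arrowCongr (Equiv.refl _) (Equiv.funUnique _ _)
  obtain ⟨s⟩ := CachingScheme.nonempty_of_determines (N := N) (K := K) (F := 1) (c := 0) (r := N)
    (fun _ _ _ => false) (fun _ W => e W) (fun W W' d k _ h => by rw [e.injective h])
  simpa using s.achievable one_pos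

/-- Caching all the files, so that nothing has to be broadcast. -/
theorem achievable_zero_rate (N K : ℕ) : Achievable N K N 0 := by
  have e : (Fin N → Fin 1 → Bool) ≃ Bits N := Equiv.arrowCongr (Equiv.refl _) (Equiv.funUnique _ _)
  obtain ⟨s⟩ := CachingScheme.nonempty_of_determines (N := N) (K := K) (F := 1) (c := N) (r := 0)
    (fun _ W => e W) (fun _ _ _ => false) (fun W W' d k h _ => by rw [e.injective h])
  simpa using s.achievable one_pos

/-! ### Linear schemes -/

theorem Submodule.exists_fin_span_eq {F V : Type*} [Field F] [AddCommGroup V] [Module F V]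
    [FiniteDimensional F V] (U : Submodule F V) {q : ℕ} (h : Module.finrank F U ≤ q) :
    ∃ f : Fin q → V, Submodule.span F (Set.range f) = U := by
  let b := Module.finBasis F U
  refine ⟨fun i => if hi : (i : ℕ) < Module.finrank F U then (b ⟨i, hi⟩ : V) else 0, ?_⟩
  apply le_antisymm
  · rw [Submodule.span_le]
    rintro _ ⟨i, rfl⟩
    dsimp only
    split_ifs
    · exact (b _).2
    · exact U.zero_mem
  · have hU : U = Submodule.span F (Set.range fun i => (b i : V)) := by
      have := congrArg (Submodule.map U.subtype) b.span_eq
      rw [Submodule.map_span, Submodule.map_top, Submodule.range_subtype, ← Set.range_comp] at this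
      exact this.symm
    conv_lhs => rw [hU]
    rw [Submodule.span_le]
    rintro _ ⟨i, rfl⟩
    refine Submodule.subset_span ⟨Fin.castLE h i, ?_⟩
    simp

/-- A linear caching scheme over a field with `2 ^ m` elements. Every file consists of `p` symbols,
the symbols being the values of a linear form at the linearly independent vectors `a n i`; user `k`
stores the values of the form on the subspace `C k`, and its values on `D d` are broadcast. -/
theorem achievable_of_linear {F V : Type*} [Field F] [Fintype F] [AddCommGroup V] [Module F V]
    [FiniteDimensional F V] {N K m p q r : ℕ} {ι : Type*} [Fintype ι] (hm : 0 < m)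
    (hp : 0 < p) (hι : Fintype.card ι = p) (hF : Fintype.card F = 2 ^ m) {a : Fin N → ι → V}
    (ha : LinearIndependent F fun x : Fin N × ι => a x.1 x.2)
    (C : Fin K → Submodule F V) (D : (Fin K → Fin N) → Submodule F V)
    (hC : ∀ k, Module.finrank F (C k) ≤ q) (hD : ∀ d, Module.finrank F (D d) ≤ r)
    (hdec : ∀ d k i, a (d k) i ∈ C k ⊔ D d) :
    Achievable N K ((q : ℝ) / p) ((r : ℝ) / p) := by
  choose f hf using fun k => (C k).exists_fin_span_eq (hC k)
  choose g hg using fun d => (D d).exists_fin_span_eq (hD d)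
  let eι : ι ≃ Fin p := Fintype.equivFinOfCardEq hι
  have e : F ≃ (Fin m → Bool) := Fintype.equivOfCardEq (by simp [hF])
  have E : ∀ n : ℕ, Nonempty ((Fin n → F) ≃ Bits (n * m)) := fun n =>
    ⟨((Equiv.refl (Fin n)).arrowCongr e).trans
      ((Equiv.curry (Fin n) (Fin m) Bool).symm.trans (finProdFinEquiv.arrowCongr (Equiv.refl _)))⟩
  obtain ⟨vp⟩ := E p
  obtain ⟨vq⟩ := E q
  obtain ⟨vr⟩ := E r
  have hφ : ∀ W : Library N (p * m), ∃ φ : V →ₗ[F] F, ∀ n i, φ (a n i) = vp.symm (W n) (eι i) := by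
    intro W
    obtain ⟨φ, hφ⟩ := LinearMap.exists_extend
      ((Module.Basis.span ha).constr F fun x : Fin N × ι => vp.symm (W x.1) (eι x.2))
    refine ⟨φ, fun n i => ?_⟩
    have h1 := (Module.Basis.span ha).constr_basis F
      (fun x : Fin N × ι => vp.symm (W x.1) (eι x.2)) (n, i)
    rw [← hφ] at h1
    simpa [Module.Basis.span_apply] using h1
  choose φ hφ using hφ
  obtain ⟨s⟩ := CachingScheme.nonempty_of_determines (N := N) (K := K) (F := p * m)
    (fun k W => vq fun i => φ W (f k i)) (fun d W => vr fun i => φ W (g d i)) (by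
      intro W W' d k h₁ h₂
      have h₁ := vq.injective h₁
      have h₂ := vr.injective h₂
      have hle : C k ⊔ D d ≤ LinearMap.eqLocus (φ W) (φ W') := by
        rw [← hf, ← hg]
        refine sup_le (Submodule.span_le.2 ?_) (Submodule.span_le.2 ?_)
        · rintro _ ⟨i, rfl⟩
          exact congrFun h₁ i
        · rintro _ ⟨i, rfl⟩
          exact congrFun h₂ i
      apply vp.symm.injective
      funext j
      obtain ⟨i, rfl⟩ := eι.surjective j
      rw [← hφ, ← hφ]
      exact hle (hdec d k i))
  have := s.achievable (Nat.mul_pos hp hm)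
  have hm' : (m : ℝ) ≠ 0 := by exact_mod_cast hm.ne'
  push_cast at this
  rwa [mul_div_mul_right _ _ hm', mul_div_mul_right _ _ hm'] at this

/-! ### The Maddah-Ali–Niesen scheme -/

theorem finrank_span_range_pairs_le {F V : Type*} [Field F] [AddCommGroup V] [Module F V]
    {α : Type*} {N : ℕ} (A : Finset α) (f : Fin N → α → V) :
    Module.finrank F (Submodule.span F {v | ∃ n, ∃ T ∈ A, v = f n T}) ≤ N * A.card := by
  have : {v | ∃ n, ∃ T ∈ A, v = f n T}
      = Set.range fun x : Fin N × A => f x.1 x.2 := by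
    ext v
    constructor
    · rintro ⟨n, T, hT, rfl⟩
      exact ⟨(n, ⟨T, hT⟩), rfl⟩
    · rintro ⟨⟨n, T⟩, rfl⟩
      exact ⟨n, T, T.2, rfl⟩
  rw [this]
  refine (finrank_range_le_card _).trans ?_
  simp

/-- Every subfile `(n, S)`, `|S| = s + 1`, is stored by the users in `S`; for every set `B` of
`s + 2` users, the sum of the subfiles `(d i, B \ {i})`, `i ∈ B`, is broadcast. -/
theorem achievable_maddahAliNiesen {N K s : ℕ} (hs : s + 1 ≤ K) :
    Achievable N K (((N * (K - 1).choose s : ℕ) : ℝ) / (K.choose (s + 1) : ℕ))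
      (((K.choose (s + 2) : ℕ) : ℝ) / (K.choose (s + 1) : ℕ)) := by
  classical
  let b : Fin N → Finset (Fin K) → (Fin N × Finset (Fin K) → ZMod 2) :=
    fun n S => Pi.single (n, S) 1
  have hb : LinearIndependent (ZMod 2) fun x : Fin N × Finset (Fin K) => b x.1 x.2 := by
    convert (Pi.basisFun (ZMod 2) (Fin N × Finset (Fin K))).linearIndependent using 1
    ext x
    simp [b]
  let C : Fin K → Submodule (ZMod 2) (Fin N × Finset (Fin K) → ZMod 2) := fun k =>
    Submodule.span _ {v | ∃ n, ∃ T ∈ Finset.powersetCard s (Finset.univ.erase k),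
      v = b n (insert k T)}
  have hC : ∀ k n S, S.card = s + 1 → k ∈ S → b n S ∈ C k := by
    intro k n S hS hk
    refine Submodule.subset_span ⟨n, S.erase k, ?_, by rw [Finset.insert_erase hk]⟩
    rw [Finset.mem_powersetCard, Finset.card_erase_of_mem hk, hS]
    exact ⟨Finset.erase_subset_erase _ (Finset.subset_univ _), rfl⟩
  refine achievable_of_linear (F := ZMod 2) (m := 1) (ι := {S : Finset (Fin K) // S.card = s + 1})
    one_pos (Nat.choose_pos hs) (by simp) (by simp) (a := fun n S => b n S) ?_ C
    (fun d => Submodule.span _ (Set.range fun B : {B : Finset (Fin K) // B.card = s + 2} =>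
      ∑ i ∈ B.1, b (d i) (B.1.erase i))) ?_ ?_ ?_
  · exact hb.comp (fun x : Fin N × {S : Finset (Fin K) // S.card = s + 1} => (x.1, x.2.1))
      (fun x y h => by
        rw [Prod.ext_iff] at h
        exact Prod.ext h.1 (Subtype.ext h.2))
  · intro k
    refine (finrank_span_range_pairs_le _ fun n T => b n (insert k T)).trans ?_
    simp
  · intro d
    exact (finrank_range_le_card _).trans (by simp)
  · rintro d k ⟨S, hS⟩
    by_cases hk : k ∈ S
    · exact Submodule.mem_sup_left (hC k _ S hS hk)
    · have hB : ∑ i ∈ insert k S, b (d i) ((insert k S).erase i)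
          = b (d k) S + ∑ i ∈ S, b (d i) ((insert k S).erase i) := by
        rw [Finset.sum_insert hk, Finset.erase_insert hk]
      have hr : ∑ i ∈ S, b (d i) ((insert k S).erase i) ∈ C k := by
        refine Submodule.sum_mem _ fun i hi => hC k _ _ ?_ ?_
        · rw [Finset.card_erase_of_mem (Finset.mem_insert_of_mem hi),
            Finset.card_insert_of_notMem hk, hS]
          rfl
        · rw [Finset.mem_erase]
          exact ⟨fun h => hk (h ▸ hi), Finset.mem_insert_self _ _⟩
      change b (d k) S ∈ _
      rw [← add_sub_cancel_right (b (d k) S) (∑ i ∈ S, b (d i) ((insert k S).erase i)), ← hB]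
      refine Submodule.sub_mem _ (Submodule.mem_sup_right (Submodule.subset_span ?_))
        (Submodule.mem_sup_left hr)
      exact ⟨⟨insert k S, by rw [Finset.card_insert_of_notMem hk, hS]⟩, rfl⟩

/-! ### Generic subspaces over large finite fields -/

open scoped Pointwise in
theorem Submodule.exists_mem_forall_notMem_of_card_lt {F V ι : Type*} [Field F] [Fintype F]
    [AddCommGroup V] [Module F V] [Fintype ι] (E : Submodule F V) (U : ι → Submodule F V)
    (hU : ∀ i, ¬ E ≤ U i) (hι : Fintype.card ι < Fintype.card F) :
    ∃ x ∈ E, ∀ i, x ∉ U i := by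
  by_contra! h
  let H : ι → AddSubgroup E := fun i => ((U i).comap E.subtype).toAddSubgroup
  have hcover : ⋃ i ∈ (Finset.univ : Finset ι), ((0 : E) +ᵥ (H i : Set E)) = Set.univ := by
    rw [Set.eq_univ_iff_forall]
    intro x
    obtain ⟨i, hi⟩ := h x x.2
    simp only [Finset.mem_univ, Set.iUnion_true, zero_vadd, Set.mem_iUnion]
    exact ⟨i, hi⟩
  obtain ⟨i, -, hfin, hidx⟩ := AddSubgroup.exists_index_le_card_of_leftCoset_cover hcover
  obtain ⟨x, hxE, hxU⟩ := SetLike.not_le_iff_exists.1 (hU i)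
  have hfin' : Finite (E ⧸ H i) := AddSubgroup.finite_quotient_of_finiteIndex
  have hinj : Function.Injective fun c : F => (QuotientAddGroup.mk (c • (⟨x, hxE⟩ : E)) : E ⧸ H i) := by
    intro c c' hcc
    rw [QuotientAddGroup.eq] at hcc
    have hmem : (c' - c) • x ∈ U i := by
      have : -(c • x) + c' • x ∈ U i := hcc
      rwa [neg_add_eq_sub, ← sub_smul] at this
    by_contra hne
    exact hxU (((U i).smul_mem_iff (sub_ne_zero.2 (Ne.symm hne))).1 hmem)
  have := Nat.card_le_card_of_injective _ hinj
  rw [Nat.card_eq_fintype_card] at this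
  rw [AddSubgroup.index, Finset.card_univ] at hidx
  omega

/-- Over a field with more elements than there are given subspaces `U i` of `E`, all of codimension
at most `q` in `E`, one subspace of dimension at most `q` spans `E` together with each of them. -/
theorem Submodule.exists_finrank_le_forall_le_sup {F V ι : Type*} [Field F] [Fintype F]
    [AddCommGroup V] [Module F V] [FiniteDimensional F V] [Fintype ι] (E : Submodule F V)
    (hι : Fintype.card ι < Fintype.card F) (q : ℕ) (U : ι → Submodule F V) (hUE : ∀ i, U i ≤ E)
    (hq : ∀ i, Module.finrank F E ≤ Module.finrank F (U i) + q) :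
    ∃ C ≤ E, Module.finrank F C ≤ q ∧ ∀ i, E ≤ C ⊔ U i := by
  classical
  induction q generalizing U with
  | zero =>
    exact ⟨⊥, bot_le, by simp, fun i => by
      rw [bot_sup_eq]
      exact (Submodule.eq_of_le_of_finrank_le (hUE i) (hq i)).ge⟩
  | succ q ih =>
    obtain ⟨x, hxE, hx⟩ := Submodule.exists_mem_forall_notMem_of_card_lt E
      (fun i : {i // ¬ E ≤ U i} => U i) (fun i => i.2)
      ((Fintype.card_subtype_le _).trans_lt hι)
    have hxle : Submodule.span F {x} ≤ E := by simpa using hxE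
    obtain ⟨C, hCE, hCq, hC⟩ := ih (fun i => Submodule.span F {x} ⊔ U i)
      (fun i => sup_le hxle (hUE i)) (by
        intro i
        by_cases hi : E ≤ U i
        · exact (Submodule.finrank_mono (hi.trans le_sup_right)).trans (Nat.le_add_right _ _)
        · have hlt : U i < Submodule.span F {x} ⊔ U i := by
            refine lt_of_le_of_ne le_sup_right fun h => hx ⟨i, hi⟩ ?_
            change x ∈ U i
            rw [h]
            exact Submodule.mem_sup_left (Submodule.mem_span_singleton_self x)
          have := Submodule.finrank_lt_finrank_of_lt hlt
          have := hq i
          omega)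
    refine ⟨C ⊔ Submodule.span F {x}, sup_le hCE hxle, ?_, fun i => ?_⟩
    · have h1 := Submodule.finrank_add_le_finrank_add_finrank C (Submodule.span F {x})
      have h2 : Module.finrank F (Submodule.span F {x}) ≤ 1 := by
        simpa using finrank_span_le_card (R := F) ({x} : Set V)
      omega
    · rw [sup_assoc]
      exact hC i

/-! ### Leaders -/

/-- For every demand vector `d` there are `N` distinct leaders `ℓ j` such that the leader `ℓ n` of
a requested file `n` requests it, and a map `c` that assigns to every user the index of a leader
with the same request, and to every leader its own index. -/
theorem exists_leaders {N K : ℕ} (hNK : N ≤ K) (d : Fin K → Fin N) :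
    ∃ (ℓ : Fin N → Fin K) (c : Fin K → Fin N), (∀ j, c (ℓ j) = j) ∧ (∀ k, d (ℓ (c k)) = d k) ∧
      ∀ k, d (ℓ (d k)) = d k := by
  classical
  rcases isEmpty_or_nonempty (Fin K) with hK | hK
  · obtain rfl : K = 0 := by
      by_contra hK0
      exact hK.false ⟨0, Nat.pos_of_ne_zero hK0⟩
    obtain rfl : N = 0 := by omega
    exact ⟨finZeroElim, finZeroElim, finZeroElim, finZeroElim, finZeroElim⟩
  have hinv : ∀ n ∈ Finset.univ.image d, d (Function.invFun d n) = n := fun n hn => by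
    obtain ⟨k, -, hk⟩ := Finset.mem_image.1 hn
    exact Function.invFun_eq ⟨k, hk⟩
  have hinj : Set.InjOn (Function.invFun d) (Finset.univ.image d : Finset (Fin N)) := by
    intro n hn n' hn' h
    rw [← hinv n hn, h, hinv n' hn']
  obtain ⟨t, hst, -, ht⟩ := Finset.exists_subsuperset_card_eq
    (Finset.subset_univ ((Finset.univ.image d).image (Function.invFun d)))
    (n := N) (by
      rw [Finset.card_image_of_injOn hinj]
      exact (Finset.card_le_univ _).trans (by simp)) (by simpa using hNK)
  obtain ⟨g, hg⟩ := Finset.exists_equiv_extend_of_card_eq (by simp [ht]) hst hinj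
  have hd : ∀ k, d (g (d k)) = d k := fun k => by
    have hk : d k ∈ Finset.univ.image d := Finset.mem_image_of_mem d (Finset.mem_univ k)
    rw [hg _ hk, hinv _ hk]
  refine ⟨fun j => g j, fun k => if hk : k ∈ t then g.symm ⟨k, hk⟩ else d k, ?_, ?_, hd⟩
  · intro j
    simp
  · intro k
    dsimp only
    split_ifs with hk
    · simp
    · exact hd k

/-- For an idempotent map `δ`, sets `Q` can be enlarged monotonically from `δ '' Q` to sets of the
same cardinality as `Q`: in each fibre of `δ` on `Q` one element (the common value of `δ`, or else
the smallest element) is replaced by its image, and the others are kept. -/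
theorem exists_monotone_card_eq_of_idempotent {α : Type*} [LinearOrder α] (δ : α → α)
    (hδ : ∀ j, δ (δ j) = δ j) :
    ∃ 𝒟 : Finset α → Finset α, Monotone 𝒟 ∧ (∀ Q, (𝒟 Q).card = Q.card) ∧
      ∀ Q, ∀ j ∈ Q, δ j ∈ 𝒟 Q := by
  classical
  let first : Finset α → α → Prop := fun Q j =>
    δ j = j ∨ (δ j ∉ Q ∧ ∀ i ∈ Q, δ i = δ j → j ≤ i)
  let τ : Finset α → α → α := fun Q j => if first Q j then δ j else j
  have hfirst : ∀ Q : Finset α, ∀ j ∈ Q, ∃ i ∈ Q, first Q i ∧ δ i = δ j := by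
    intro Q j hj
    by_cases h : δ j ∈ Q
    · exact ⟨δ j, h, Or.inl (hδ j), hδ j⟩
    · obtain ⟨i, hi, hmin⟩ := (Q.filter fun i => δ i = δ j).exists_minimal
        ⟨j, Finset.mem_filter.2 ⟨hj, rfl⟩⟩
      rw [Finset.mem_filter] at hi
      refine ⟨i, hi.1, Or.inr ⟨hi.2 ▸ h, fun i' hi' he => ?_⟩, hi.2⟩
      rcases le_total i i' with h' | h'
      · exact h'
      · exact hmin (Finset.mem_filter.2 ⟨hi', he.trans hi.2⟩) h'
  have hmem : ∀ Q : Finset α, ∀ j ∈ Q, δ j ∈ Q.image (τ Q) := by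
    intro Q j hj
    obtain ⟨i, hi, hif, hij⟩ := hfirst Q j hj
    exact Finset.mem_image.2 ⟨i, hi, by rw [← hij]; exact if_pos hif⟩
  refine ⟨fun Q => Q.image (τ Q), ?_, ?_, hmem⟩
  · intro Q Q' hQ x hx
    obtain ⟨j, hj, rfl⟩ := Finset.mem_image.1 hx
    by_cases h : first Q j
    · rw [show τ Q j = δ j from if_pos h]
      exact hmem Q' j (hQ hj)
    · have h' : ¬ first Q' j := by
        rintro (h1 | ⟨h1, h2⟩)
        · exact h (Or.inl h1)
        · exact h (Or.inr ⟨fun h3 => h1 (hQ h3), fun i hi => h2 i (hQ hi)⟩)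
      exact Finset.mem_image.2 ⟨j, hQ hj, by rw [show τ Q j = j from if_neg h]; exact if_neg h'⟩
  · intro Q
    refine Finset.card_image_of_injOn fun i hi j hj hij => ?_
    simp only [τ] at hij
    split_ifs at hij with h1 h2 h2
    · rcases h1 with h1 | ⟨h1, h1'⟩ <;> rcases h2 with h2 | ⟨h2, h2'⟩
      · rw [← h1, hij, h2]
      · exact absurd (by rw [← hij, h1]; exact hi) h2
      · exact absurd (by rw [hij, h2]; exact hj) h1
      · exact le_antisymm (h1' j hj hij.symm) (h2' i hi hij)
    · exact absurd (Or.inl (by rw [← hij, hδ])) h2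
    · exact absurd (Or.inl (by rw [hij, hδ])) h1
    · exact hij

/-! ### Bases of the exterior algebra -/

section ExteriorBasis

variable {R M I : Type*} [LinearOrder I] [CommRing R] [AddCommGroup M] [Module R M]
  (b : Module.Basis I R M)

theorem ExteriorAlgebra.basis_singleton (k : I) :
    b.ExteriorAlgebra {k} = ExteriorAlgebra.ι R (b k) := by
  rw [ExteriorAlgebra.basis_apply_ofCard b (n := 1) (Finset.card_singleton k)]
  have h := (Set.powersetCard.mem_range_ofFinEmbEquiv_symm_iff_mem
    (Set.powersetCard.ofCard (Finset.card_singleton k)) _).1 ⟨0, rfl⟩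
  have h' := Finset.mem_singleton.1 (show _ ∈ ({k} : Finset I) from h)
  simp [ExteriorAlgebra.ιMulti_family, ExteriorAlgebra.ιMulti_apply, h']

theorem ExteriorAlgebra.ι_mul_basis_of_mem {k : I} {T : Finset I} (hk : k ∈ T) :
    ExteriorAlgebra.ι R (b k) * b.ExteriorAlgebra T = 0 := by
  rw [← ExteriorAlgebra.basis_singleton]
  exact ExteriorAlgebra.basis_mul_of_not_disjoint b
    (Set.powersetCard.ofCard (Finset.card_singleton k)) (Set.powersetCard.ofCard (s := T) rfl)
    (by simpa using hk)

theorem ExteriorAlgebra.ι_mul_basis_of_notMem {k : I} {T : Finset I} (hk : k ∉ T) :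
    ∃ ε : Rˣ, ExteriorAlgebra.ι R (b k) * b.ExteriorAlgebra T
      = (ε : R) • b.ExteriorAlgebra (insert k T) := by
  rw [← ExteriorAlgebra.basis_singleton]
  have := ExteriorAlgebra.basis_mul_of_disjoint b
    (Set.powersetCard.ofCard (Finset.card_singleton k)) (Set.powersetCard.ofCard (s := T) rfl)
    (by simpa using hk)
  have hu : (Set.powersetCard.disjUnion (s := Set.powersetCard.ofCard (Finset.card_singleton k))
      (t := Set.powersetCard.ofCard (s := T) rfl) (by simpa using hk)).1 = insert k T := by
    ext x
    simp [Set.powersetCard.disjUnion]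
  rw [hu] at this
  obtain ⟨u, hu'⟩ : ∃ u : ℤˣ, b.ExteriorAlgebra {k} * b.ExteriorAlgebra T
      = u • b.ExteriorAlgebra (insert k T) := ⟨_, this⟩
  refine ⟨Units.map (Int.castRingHom R).toMonoidHom u, hu'.trans ?_⟩
  rw [Units.smul_def]
  exact (Int.cast_smul_eq_zsmul R _ _).symm

/-- Products of `|T|` vectors of one basis are combinations of those of another. -/
theorem ExteriorAlgebra.basis_mem_span_card_eq {I' : Type*} [LinearOrder I']
    (b' : Module.Basis I' R M) (T : Finset I) :
    b.ExteriorAlgebra T ∈ Submodule.span R {x | ∃ S : Finset I', S.card = T.card ∧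
      x = b'.ExteriorAlgebra S} := by
  have hT : b.ExteriorAlgebra T
      = (b.exteriorPower T.card (Set.powersetCard.ofCard rfl) : ExteriorAlgebra R M) :=
    ExteriorAlgebra.basis_eq_coe_basis b (Set.powersetCard.ofCard (s := T) rfl)
  rw [hT]
  set y := b.exteriorPower T.card (Set.powersetCard.ofCard rfl)
  have hy : y ∈ Submodule.span R (Set.range (b'.exteriorPower T.card)) := by
    rw [Module.Basis.span_eq]
    exact Submodule.mem_top
  have := Submodule.mem_map_of_mem (f := (⋀[R]^T.card M).subtype) hy
  rw [Submodule.map_span, ← Set.range_comp] at this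
  refine Submodule.span_mono ?_ this
  rintro _ ⟨S, rfl⟩
  exact ⟨S.1, S.2, (ExteriorAlgebra.basis_eq_coe_basis b' S).symm⟩

end ExteriorBasis

/-! ### Delivery by interference elimination -/

section Delivery

variable {F : Type*} [Field F] {N K : ℕ}

theorem Finset.sum_card_filter_notMem_powersetCard {α β : Type*} [DecidableEq α] (ℓ : β → α)
    (A : Finset α) (J : Finset β) (hJ : ∀ j ∈ J, ℓ j ∈ A) (t : ℕ) :
    ∑ S ∈ A.powersetCard t, (J.filter fun j => ℓ j ∉ S).card = J.card * (A.card - 1).choose t := by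
  simp_rw [Finset.card_filter]
  rw [Finset.sum_comm, Finset.card_eq_sum_ones, Finset.sum_mul]
  refine Finset.sum_congr rfl fun j hj => ?_
  rw [← Finset.card_filter, one_mul, ← Finset.card_erase_of_mem (hJ j hj),
    ← Finset.card_powersetCard]
  congr 1
  ext S
  simp only [Finset.mem_filter, Finset.mem_powersetCard, Finset.subset_erase]
  tauto

variable (F N K) in
/-- The subfile `(n, S)` is represented by the exterior product of the standard basis vectors
indexed by `S`, in the `n`-th copy of the exterior algebra of `F ^ K`. -/
noncomputable def subfile (n : Fin N) (S : Finset (Fin K)) :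
    Fin N → ExteriorAlgebra F (Fin K → F) :=
  Pi.single n ((Pi.basisFun F (Fin K)).ExteriorAlgebra S)

variable (F N K) in
theorem linearIndependent_subfile :
    LinearIndependent F fun x : Fin N × Finset (Fin K) => subfile F N K x.1 x.2 := by
  have h := (Pi.basis fun _ : Fin N => (Pi.basisFun F (Fin K)).ExteriorAlgebra).linearIndependent
  have h' := h.comp (Equiv.sigmaEquivProd (Fin N) (Finset (Fin K))).symm (Equiv.injective _)
  have heq : (fun x : Fin N × Finset (Fin K) => subfile F N K x.1 x.2)
      = (Pi.basis fun _ : Fin N => (Pi.basisFun F (Fin K)).ExteriorAlgebra) ∘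
        (Equiv.sigmaEquivProd (Fin N) (Finset (Fin K))).symm := by
    funext x
    simp [subfile]
  rw [heq]
  exact h'

variable (F N) in
/-- The span of the subfiles `(n, S)` with `k ∈ S` and `|S| = s + 1`. -/
noncomputable def userSubspace (s : ℕ) (k : Fin K) :
    Submodule F (Fin N → ExteriorAlgebra F (Fin K → F)) :=
  Submodule.span F {v | ∃ n, ∃ T ∈ Finset.powersetCard s (Finset.univ.erase k),
    v = subfile F N K n (insert k T)}

instance finiteDimensional_exteriorAlgebra_pi : FiniteDimensional F (ExteriorAlgebra F (Fin K → F)) :=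
  Module.Finite.of_basis (Pi.basisFun F (Fin K)).ExteriorAlgebra

theorem single_ι_mul_mem_userSubspace {s : ℕ} {k : Fin K}
    (f : Module.Basis (Fin K) F (Fin K → F)) {T : Finset (Fin K)} (hT : T.card = s) (n : Fin N) :
    Pi.single n (ExteriorAlgebra.ι F (Pi.basisFun F (Fin K) k) * f.ExteriorAlgebra T)
      ∈ userSubspace F N s k := by
  have h := ExteriorAlgebra.basis_mem_span_card_eq f (Pi.basisFun F (Fin K)) T
  rw [hT] at h
  refine Submodule.span_induction (p := fun x _ =>
    Pi.single n (ExteriorAlgebra.ι F (Pi.basisFun F (Fin K) k) * x) ∈ userSubspace F N s k)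
    ?_ ?_ ?_ ?_ h
  · rintro _ ⟨S, hS, rfl⟩
    by_cases hk : k ∈ S
    · rw [ExteriorAlgebra.ι_mul_basis_of_mem _ hk, Pi.single_zero]
      exact Submodule.zero_mem _
    · obtain ⟨ε, hε⟩ := ExteriorAlgebra.ι_mul_basis_of_notMem (Pi.basisFun F (Fin K)) hk
      rw [hε, Pi.single_smul]
      refine Submodule.smul_mem _ _ (Submodule.subset_span ⟨n, S, ?_, rfl⟩)
      rw [Finset.mem_powersetCard, Finset.subset_erase]
      exact ⟨⟨Finset.subset_univ _, hk⟩, hS⟩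
  · rw [mul_zero, Pi.single_zero]
    exact Submodule.zero_mem _
  · intro x y _ _ hx hy
    rw [mul_add, Pi.single_add]
    exact Submodule.add_mem _ hx hy
  · intro a x _ hx
    rw [mul_smul_comm, Pi.single_smul]
    exact Submodule.smul_mem _ _ hx

/-- Subtracting from every standard basis vector the one of its leader, unless it is a leader
itself, gives a basis. -/
theorem exists_leader_basis (lead : Fin K → Fin K) (hlead : ∀ k, lead (lead k) = lead k) :
    ∃ f : Module.Basis (Fin K) F (Fin K → F), ∀ k,
      Pi.basisFun F (Fin K) k = f k + if lead k = k then 0 else f (lead k) := by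
  let e := Pi.basisFun F (Fin K)
  let g : Fin K → (Fin K → F) := fun k => if lead k = k then e k else e k - e (lead k)
  have hg : ∀ k, e k = g k + if lead k = k then 0 else g (lead k) := by
    intro k
    by_cases h : lead k = k
    · simp [g, h]
    · simp [g, h, hlead]
  have hspan : ⊤ ≤ Submodule.span F (Set.range g) := by
    rw [← e.span_eq, Submodule.span_le]
    rintro _ ⟨k, rfl⟩
    rw [hg k]
    refine Submodule.add_mem _ (Submodule.subset_span ⟨k, rfl⟩) ?_
    split_ifs
    · exact Submodule.zero_mem _
    · exact Submodule.subset_span ⟨_, rfl⟩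
  refine ⟨basisOfTopLeSpanOfCardEqFinrank g hspan (by simp), fun k => ?_⟩
  rw [coe_basisOfTopLeSpanOfCardEqFinrank]
  exact hg k

/-- The delivery for a demand vector `d`, with `N (K - 1).choose (s + 1)` broadcast symbols. User `k`
learns from it the whole file `d k` once it knows the subfiles stored by it, and enough forms in those
subfiles alone. With `Φ S` the exterior products of the basis of `exists_leader_basis`, the broadcast
consists of `Φ S` in the copies `n ∈ 𝒟 (Q S)`, where `Q S` is the set of the indices of the leaders
outside `S`; so copies of one requested file with several leaders share the load of the files that
nobody requests. -/
theorem exists_delivery_subspace (hNK : N ≤ K) (s : ℕ) (d : Fin K → Fin N) :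
    ∃ D : Submodule F (Fin N → ExteriorAlgebra F (Fin K → F)),
      Module.finrank F D ≤ N * (K - 1).choose (s + 1) ∧ ∀ k,
        (N - 1) * (K - 2).choose s ≤ Module.finrank F ↥(D ⊓ userSubspace F N s k) ∧
        ∀ S : Finset (Fin K), S.card = s + 1 →
          subfile F N K (d k) S ∈ userSubspace F N s k ⊔ D := by
  classical
  obtain ⟨ℓ, c, hcℓ, hdc, hdd⟩ := exists_leaders hNK d
  obtain ⟨𝒟, hmono, hcard, hmem⟩ := exists_monotone_card_eq_of_idempotent (fun j => d (ℓ j))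
    (fun j => hdd (ℓ j))
  obtain ⟨f, hf⟩ := exists_leader_basis (F := F) (fun k => ℓ (c k)) (fun k => by simp only [hcℓ])
  let Q : Finset (Fin K) → Finset (Fin N) := fun S => Finset.univ.filter fun j => ℓ j ∉ S
  let Φ := f.ExteriorAlgebra
  let A : Finset (Σ _ : Finset (Fin K), Fin N) :=
    (Finset.univ.powersetCard (s + 1)).sigma fun S => 𝒟 (Q S)
  let D : Submodule F (Fin N → ExteriorAlgebra F (Fin K → F)) :=
    Submodule.span F ↑(A.image fun x =>
      (Pi.single x.2 (Φ x.1) : Fin N → ExteriorAlgebra F (Fin K → F)))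
  have hD : ∀ S n, S.card = s + 1 → n ∈ 𝒟 (Q S) → Pi.single n (Φ S) ∈ D := by
    intro S n hS hn
    refine Submodule.subset_span (Finset.mem_image.2 ⟨⟨S, n⟩, ?_, rfl⟩)
    simp [A, hS, hn]
  -- A product with a basis vector that already occurs vanishes, so nothing is asked of `n` then.
  have hDmul : ∀ i T n, T.card = s → (i ∉ T → n ∈ 𝒟 (Q (insert i T))) →
      Pi.single n (ExteriorAlgebra.ι F (f i) * Φ T) ∈ D := by
    intro i T n hT hn
    by_cases hi : i ∈ T
    · rw [ExteriorAlgebra.ι_mul_basis_of_mem f hi, Pi.single_zero]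
      exact Submodule.zero_mem _
    · obtain ⟨ε, hε⟩ := ExteriorAlgebra.ι_mul_basis_of_notMem f hi
      rw [hε, Pi.single_smul]
      exact Submodule.smul_mem _ _ (hD _ _ (by rw [Finset.card_insert_of_notMem hi, hT]) (hn hi))
  refine ⟨D, ?_, fun k => ⟨?_, ?_⟩⟩
  · refine (finrank_span_finset_le_card _).trans (Finset.card_image_le.trans ?_)
    rw [Finset.card_sigma, Finset.sum_congr rfl fun S _ => hcard (Q S),
      Finset.sum_card_filter_notMem_powersetCard ℓ _ _ (fun _ _ => Finset.mem_univ _)]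
    simp
    -- With `e` the standard basis, `e k * Φ T` is, up to signs, `Φ (T ∪ {k}) + Φ (T ∪ {ℓ (c k)})`,
    -- the second term being absent if `k` is a leader or `ℓ (c k) ∈ T`. Monotonicity of `𝒟` puts
    -- both terms in copy `n` of `D` when `n ∈ 𝒟 (Q (T ∪ {ℓ (c k)}))`; this is the index set `P`.
  · let P : Finset (Σ _ : Finset (Fin K), Fin N) :=
      ((Finset.univ.erase k).powersetCard s).sigma fun T => 𝒟 (Q (insert (ℓ (c k)) T))
    have hP : ∀ x ∈ P, k ∉ x.1 ∧ x.1.card = s ∧ x.2 ∈ 𝒟 (Q (insert (ℓ (c k)) x.1)) := by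
      intro x hx
      simp only [P, Finset.mem_sigma, Finset.mem_powersetCard, Finset.subset_erase] at hx
      exact ⟨hx.1.1.2, hx.1.2, hx.2⟩
    let w : P → (Fin N → ExteriorAlgebra F (Fin K → F)) := fun x =>
      Pi.single x.1.2 (ExteriorAlgebra.ι F (Pi.basisFun F (Fin K) k) * Φ x.1.1)
    have hwD : ∀ x, w x ∈ D ⊓ userSubspace F N s k := by
      intro x
      obtain ⟨hk, hs, hn⟩ := hP x x.2
      refine ⟨?_, single_ι_mul_mem_userSubspace f hs _⟩
      simp only [w, hf k, map_add, add_mul, Pi.single_add]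
      have hsub : Q (insert (ℓ (c k)) x.1.1) ⊆ Q (insert k x.1.1) := by
        intro j hj
        simp only [Q, Finset.mem_filter, Finset.mem_univ, true_and, Finset.mem_insert,
          not_or] at hj ⊢
        refine ⟨?_, hj.2⟩
        rintro rfl
        exact hj.1 (by rw [hcℓ])
      refine Submodule.add_mem _ (hDmul _ _ _ hs fun _ => hmono hsub hn) ?_
      split_ifs with hl
      · simp
      · exact hDmul _ _ _ hs fun _ => hn
    -- Among the `Φ`-coordinates at sets containing `k`, exactly one of `e k * Φ T` is nonzero.
    have hcoord : ∀ x ∈ P, ∃ ε : Fˣ, ∀ y ∈ P, Φ.coord (insert k x.1)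
        (ExteriorAlgebra.ι F (Pi.basisFun F (Fin K) k) * Φ y.1)
          = if x.1 = y.1 then (ε : F) else 0 := by
      intro x hx
      obtain ⟨ε, hε⟩ := ExteriorAlgebra.ι_mul_basis_of_notMem f (hP x hx).1
      refine ⟨ε, fun y hy => ?_⟩
      have h0 : Φ.coord (insert k x.1)
          (ExteriorAlgebra.ι F (if ℓ (c k) = k then 0 else f (ℓ (c k))) * Φ y.1) = 0 := by
        split_ifs with hl
        · simp
        · by_cases hly : ℓ (c k) ∈ y.1
          · rw [ExteriorAlgebra.ι_mul_basis_of_mem f hly, map_zero]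
          · obtain ⟨ε', hε'⟩ := ExteriorAlgebra.ι_mul_basis_of_notMem f hly
            rw [hε', map_smul, Module.Basis.coord_apply, Module.Basis.repr_self,
              Finsupp.single_eq_of_ne, smul_zero]
            intro h
            have : k ∈ insert (ℓ (c k)) y.1 := h ▸ Finset.mem_insert_self _ _
            rcases Finset.mem_insert.1 this with h | h
            · exact hl h.symm
            · exact (hP y hy).1 h
      rw [hf k, map_add, add_mul, map_add, h0, add_zero]
      split_ifs with hxy
      · rw [← hxy, hε, map_smul, Module.Basis.coord_apply, Module.Basis.repr_self,
          Finsupp.single_eq_same, smul_eq_mul, mul_one]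
      · obtain ⟨ε', hε'⟩ := ExteriorAlgebra.ι_mul_basis_of_notMem f (hP y hy).1
        rw [hε', map_smul, Module.Basis.coord_apply, Module.Basis.repr_self,
          Finsupp.single_eq_of_ne, smul_zero]
        intro h
        exact hxy (by
          rw [← Finset.erase_insert (hP x hx).1, h, Finset.erase_insert (hP y hy).1])
    choose! ε hε using hcoord
    have hw : LinearIndependent F w := by
      refine LinearIndependent.of_pairwise_dual_eq_zero_one w
        (fun x => (((ε x.1)⁻¹ : Fˣ) : F) • (Φ.coord (insert k x.1.1)) ∘ₗ LinearMap.proj x.1.2)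
        (fun x y hxy => ?_) (fun x => ?_)
      · by_cases h2 : x.1.2 = y.1.2
        · have h1 : x.1.1 ≠ y.1.1 := fun h1 =>
            hxy (Subtype.ext (Sigma.ext h1 (heq_of_eq h2)))
          simp only [LinearMap.smul_apply, LinearMap.comp_apply, LinearMap.proj_apply, w, h2,
            Pi.single_eq_same, hε x x.2 y y.2, if_neg h1, smul_zero]
        · simp only [LinearMap.smul_apply, LinearMap.comp_apply, LinearMap.proj_apply, w,
            Pi.single_eq_of_ne h2, map_zero, smul_zero]
      · simp only [LinearMap.smul_apply, LinearMap.comp_apply, LinearMap.proj_apply, w,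
          Pi.single_eq_same, hε x x.2 x x.2, if_true, smul_eq_mul, Units.inv_mul]
    have hle : Submodule.span F (Set.range w) ≤ D ⊓ userSubspace F N s k :=
      Submodule.span_le.2 (by rintro _ ⟨x, rfl⟩; exact hwD x)
    have hfin := Submodule.finrank_mono hle
    rw [finrank_span_eq_card hw, Fintype.card_coe, Finset.card_sigma,
      Finset.sum_congr rfl fun T _ => hcard (Q (insert (ℓ (c k)) T))] at hfin
    have hQ : ∀ T, Q (insert (ℓ (c k)) T) = (Finset.univ.erase (c k)).filter fun j => ℓ j ∉ T := by
      intro T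
      have hinj : Function.Injective ℓ := fun i j h => by rw [← hcℓ i, h, hcℓ]
      ext j
      simp only [Q, Finset.mem_filter, Finset.mem_univ, true_and, Finset.mem_insert, not_or,
        Finset.mem_erase, and_true, hinj.eq_iff]
    rw [Finset.sum_congr rfl fun T _ => congrArg Finset.card (hQ T),
      Finset.sum_card_filter_notMem_powersetCard ℓ] at hfin
    · simpa [Nat.sub_sub] using hfin
    · intro j hj
      rw [Finset.mem_erase] at hj ⊢
      exact ⟨fun h => hj.1 (by rw [← h, hcℓ]), Finset.mem_univ _⟩
    -- `Φ S` is in the copy `d k` of `D` if `ℓ (c k) ∉ S`. Otherwise the factor `f (ℓ (c k))` equals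
    -- `e k - f k`, or `e k` if `k` is a leader; the term with `f k` has no factor `f (ℓ (c k))`.
  · have hΦ : ∀ S : Finset (Fin K), S.card = s + 1 →
        Pi.single (d k) (Φ S) ∈ userSubspace F N s k ⊔ D := by
      intro S hS
      by_cases hl : ℓ (c k) ∈ S
      · set T := S.erase (ℓ (c k)) with hT
        have hlT : ℓ (c k) ∉ T := Finset.notMem_erase _ _
        have hTs : T.card = s := by rw [hT, Finset.card_erase_of_mem hl, hS]; rfl
        obtain ⟨ε, hε⟩ := ExteriorAlgebra.ι_mul_basis_of_notMem f hlT
        rw [Finset.insert_erase hl] at hε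
        have hsmul : Pi.single (d k) (Φ S) = ((ε⁻¹ : Fˣ) : F) •
            (Pi.single (d k) (ExteriorAlgebra.ι F (f (ℓ (c k))) * Φ T) :
              Fin N → ExteriorAlgebra F (Fin K → F)) := by
          rw [hε, ← Pi.single_smul, smul_smul, Units.inv_mul, one_smul]
        rw [hsmul]
        refine Submodule.smul_mem _ _ ?_
        have hE := single_ι_mul_mem_userSubspace (k := k) f hTs (d k)
        by_cases hlk : ℓ (c k) = k
        · rw [hf k, if_pos hlk, add_zero] at hE
          rw [hlk]
          exact Submodule.mem_sup_left hE
        · have hfl : f (ℓ (c k)) = Pi.basisFun F (Fin K) k - f k := by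
            rw [hf k, if_neg hlk, add_sub_cancel_left]
          rw [hfl, map_sub, sub_mul, Pi.single_sub]
          refine Submodule.sub_mem _ (Submodule.mem_sup_left hE) (Submodule.mem_sup_right
            (hDmul _ _ _ hTs fun _ => ?_))
          rw [← hdc k]
          refine hmem _ _ ?_
          simp only [Q, Finset.mem_filter, Finset.mem_univ, true_and, Finset.mem_insert, not_or]
          exact ⟨hlk, hlT⟩
      · refine Submodule.mem_sup_right (hD _ _ hS ?_)
        rw [← hdc k]
        exact hmem _ _ (by simpa [Q] using hl)
    intro S hS
    have h := ExteriorAlgebra.basis_mem_span_card_eq (Pi.basisFun F (Fin K)) f S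
    have hle : Submodule.span F {x | ∃ S' : Finset (Fin K), S'.card = S.card ∧
        x = f.ExteriorAlgebra S'} ≤ (userSubspace F N s k ⊔ D).comap
          (LinearMap.single F (fun _ => ExteriorAlgebra F (Fin K → F)) (d k)) :=
      Submodule.span_le.2 (by
        rintro _ ⟨S', hS', rfl⟩
        exact hΦ S' (hS'.trans hS))
    exact hle h

/-- The interference elimination scheme for `t = s + 1`: user `k` caches a generic subspace of
`userSubspace F N s k` that completes what the delivery reveals of it, for every demand vector. -/
theorem achievable_interferenceElimination {s : ℕ} (hNK : N ≤ K) (hs : s + 1 ≤ K) :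
    Achievable N K
      (((N * (K - 1).choose s - (N - 1) * (K - 2).choose s : ℕ) : ℝ) / (K.choose (s + 1) : ℕ))
      (((N * (K - 1).choose (s + 1) : ℕ) : ℝ) / (K.choose (s + 1) : ℕ)) := by
  classical
  -- a field of characteristic `2` with more elements than there are demand vectors
  obtain ⟨m, hm0, hm⟩ : ∃ m, 0 < m ∧ Fintype.card (Fin K → Fin N) < 2 ^ m :=
    ⟨Fintype.card (Fin K → Fin N) + 1, Nat.succ_pos _,
      (Nat.lt_succ_self _).trans Nat.lt_two_pow_self⟩
  let F := GaloisField 2 m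
  have : Finite F := inferInstance
  let _ : Fintype F := Fintype.ofFinite F
  have hF : Fintype.card F = 2 ^ m := by
    rw [← Nat.card_eq_fintype_card]
    exact GaloisField.card 2 m hm0.ne'
  choose D hDr hD using fun d : Fin K → Fin N => exists_delivery_subspace (F := F) hNK s d
  have hE : ∀ k : Fin K, Module.finrank F (userSubspace F N s k) ≤ N * (K - 1).choose s := by
    intro k
    refine (finrank_span_range_pairs_le _ fun n T => subfile F N K n (insert k T)).trans ?_
    simp
  choose C hCE hCq hC using fun k : Fin K =>
    Submodule.exists_finrank_le_forall_le_sup (userSubspace F N s k) (hm.trans_eq hF.symm)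
      (N * (K - 1).choose s - (N - 1) * (K - 2).choose s) (fun d => D d ⊓ userSubspace F N s k)
      (fun d => inf_le_right) (fun d => by
        have h1 := (hD d k).1
        have h2 := hE k
        omega)
  refine achievable_of_linear (F := F) (m := m) (ι := {S : Finset (Fin K) // S.card = s + 1})
    hm0 (Nat.choose_pos hs) (by simp) hF (a := fun n S => subfile F N K n S) ?_ C D hCq hDr ?_
  · exact (linearIndependent_subfile F N K).comp
      (fun x : Fin N × {S : Finset (Fin K) // S.card = s + 1} => (x.1, x.2.1))
      (fun x y h => by
        rw [Prod.ext_iff] at h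
        exact Prod.ext h.1 (Subtype.ext h.2))
  · rintro d k ⟨S, hS⟩
    have hle : userSubspace F N s k ⊔ D d ≤ C k ⊔ D d :=
      sup_le ((hC k d).trans (sup_le_sup_left inf_le_left _)) le_sup_right
    exact hle ((hD d k).2 S hS)

end Delivery

/-! ### The lower convex envelope -/

theorem finite_interferenceEliminationPoints (N K : ℕ) :
    (interferenceEliminationPoints N K).Finite := by
  refine ((Finset.range (K + 1)).finite_toSet.image fun t : ℕ =>
    (((t : ℝ) * (((N : ℝ) - 1) * t + K - N) / ((K : ℝ) * ((K : ℝ) - 1)),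
      (N : ℝ) * ((K : ℝ) - t) / K) : ℝ × ℝ)).subset ?_
  rintro p ⟨-, t, ht, h1, h2⟩
  exact ⟨t, by simpa [Nat.lt_succ_iff] using ht, Prod.ext h1.symm h2.symm⟩

theorem finite_maddahAliNiesenPoints (N K : ℕ) : (maddahAliNiesenPoints N K).Finite := by
  refine ((Finset.range (K + 1)).finite_toSet.image fun t : ℕ =>
    (((t : ℝ) * N / K, (K : ℝ) * (1 - ((t : ℝ) * N / K) / N) *
      min (1 / (1 + K * ((t : ℝ) * N / K) / N)) ((N : ℝ) / K)) : ℝ × ℝ)).subset ?_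
  rintro p ⟨⟨t, ht, h1⟩, h2⟩
  refine ⟨t, by simpa [Nat.lt_succ_iff] using ht, Prod.ext h1.symm ?_⟩
  rw [h2, h1]

/-- The lower convex envelope of a finite set is attained at every abscissa of its convex hull. -/
theorem isLeast_lowerConvexEnvelope {P : Set (ℝ × ℝ)} (hP : P.Finite) {M R : ℝ}
    (h : (M, R) ∈ convexHull ℝ P) :
    IsLeast {R : ℝ | (M, R) ∈ convexHull ℝ P} (lowerConvexEnvelope P M) := by
  have hcomp : IsCompact {R : ℝ | (M, R) ∈ convexHull ℝ P} := by
    have hc := (hP.isCompact_convexHull ℝ).inter_right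
      (isClosed_singleton.preimage continuous_fst : IsClosed (Prod.fst ⁻¹' {M} : Set (ℝ × ℝ)))
    have heq : {R : ℝ | (M, R) ∈ convexHull ℝ P}
        = Prod.snd '' (convexHull ℝ P ∩ Prod.fst ⁻¹' {M}) := by
      ext R
      constructor
      · intro hR
        exact ⟨(M, R), ⟨hR, rfl⟩, rfl⟩
      · rintro ⟨⟨M', R'⟩, ⟨h1, h2⟩, rfl⟩
        obtain rfl : M' = M := h2
        exact h1
    rw [heq]
    exact hc.image continuous_snd
  exact hcomp.isLeast_sInf ⟨R, h⟩

theorem achievable_of_mem_interferenceEliminationPoints {N K : ℕ} (hN : 1 ≤ N) (hNK : N ≤ K)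
    {p : ℝ × ℝ} (hp : p ∈ interferenceEliminationPoints N K) : Achievable N K p.1 p.2 := by
  obtain ⟨hK, t, ht, h1, h2⟩ := hp
  have hKR : (0 : ℝ) < K := by exact_mod_cast (show 0 < K by omega)
  rcases Nat.eq_zero_or_pos t with rfl | hpos
  · have h2' : p.2 = N := by
      rw [h2, Nat.cast_zero, sub_zero, mul_div_assoc, div_self hKR.ne', mul_one]
    rw [h1, h2', Nat.cast_zero, zero_mul, zero_div]
    exact achievable_zero_memory N K
  obtain ⟨s, rfl⟩ := Nat.exists_eq_add_of_lt hpos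
  obtain ⟨k, rfl⟩ := Nat.exists_eq_add_of_le' hK
  rw [zero_add] at ht h1 h2
  have key := achievable_interferenceElimination hNK ht
  have hsk : s ≤ k + 1 := by omega
  have hp0 : (0 : ℝ) < ((k + 2).choose (s + 1) : ℕ) := by
    exact_mod_cast Nat.choose_pos ht
  have e1 : ((k + 1).choose s : ℝ) = (k + 2).choose (s + 1) * (s + 1) / (k + 2) := by
    have := Nat.add_one_mul_choose_eq (k + 1) s
    rw [eq_div_iff (by positivity)]
    have h : ((k : ℝ) + 2) * (k + 1).choose s = (k + 2).choose (s + 1) * (s + 1) := by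
      exact_mod_cast this
    linarith
  have e2 : (k.choose s : ℝ) = (k + 1).choose s * (k + 1 - s) / (k + 1) := by
    have := Nat.choose_mul_succ_eq k s
    rw [eq_div_iff (by positivity)]
    have h := congrArg (Nat.cast (R := ℝ)) this
    push_cast [Nat.cast_sub hsk] at h
    exact h
  have e3 : ((k + 1).choose (s + 1) : ℝ) = (k + 2).choose (s + 1) * (k + 1 - s) / (k + 2) := by
    have := Nat.choose_mul_succ_eq (k + 1) (s + 1)
    rw [eq_div_iff (by positivity)]
    have h := congrArg (Nat.cast (R := ℝ)) this
    rw [show k + 1 + 1 - (s + 1) = k + 1 - s by omega] at h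
    push_cast [Nat.cast_sub hsk] at h
    rw [show (k : ℝ) + 2 = k + 1 + 1 by ring]
    exact h
  have hle : (N - 1) * k.choose s ≤ N * (k + 1).choose s :=
    Nat.mul_le_mul (Nat.sub_le _ _) (Nat.choose_le_choose s (Nat.le_succ k))
  rw [h1, h2]
  convert key using 1
  · rw [show k + 2 - 1 = k + 1 from rfl, show k + 2 - 2 = k from rfl, Nat.cast_sub hle]
    push_cast [Nat.cast_sub hN]
    rw [e2, e1, show (k : ℝ) + 2 - 1 = k + 1 by ring]
    field_simp
    ring
  · rw [show k + 2 - 1 = k + 1 from rfl]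
    push_cast
    rw [e3]
    field_simp
    ring

theorem achievable_of_mem_maddahAliNiesenPoints {N K : ℕ} (hN : 1 ≤ N) (hNK : N ≤ K) {p : ℝ × ℝ}
    (hp : p ∈ maddahAliNiesenPoints N K) : Achievable N K p.1 p.2 := by
  obtain ⟨⟨t, ht, h1⟩, h2⟩ := hp
  have hNR : (0 : ℝ) < N := by exact_mod_cast hN
  have hKR : (0 : ℝ) < K := by exact_mod_cast hN.trans hNK
  have htK : (t : ℝ) ≤ K := by exact_mod_cast ht
  have hmul : (K : ℝ) * p.1 / N = t := by
    rw [h1]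
    field_simp
  have hdiv : p.1 / N = t / K := by
    rw [h1]
    field_simp
  rw [hmul, hdiv] at h2
  -- uncoded caching of the same fraction `t / K` of every file
  have huncoded : Achievable N K p.1 (K * (1 - t / K) * (N / K)) := by
    have h := convex_achievable N K (achievable_zero_memory N K : ((0, N) : ℝ × ℝ) ∈ _)
      (achievable_zero_rate N K : ((N, 0) : ℝ × ℝ) ∈ _)
      (sub_nonneg.2 ((div_le_one hKR).2 htK)) (div_nonneg (Nat.cast_nonneg t) hKR.le)
      (sub_add_cancel _ _)
    simp only [Set.mem_ofPred_eq, Prod.smul_mk, Prod.mk_add_mk, smul_eq_mul, mul_zero, zero_add,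
      add_zero] at h
    rw [h1]
    convert h using 1
    · ring
    · field_simp
  rcases le_total (1 / (1 + (t : ℝ))) ((N : ℝ) / K) with h | h
  · rcases Nat.eq_zero_or_pos t with rfl | hpos
      -- here `N = K`, and both terms of the minimum are `1`
    · have hNK' : (N : ℝ) / K = 1 := by
        refine le_antisymm ((div_le_one hKR).2 (by exact_mod_cast hNK)) ?_
        simpa using h
      rw [h2]
      rw [hNK'] at huncoded ⊢
      simpa using huncoded
    obtain ⟨s, rfl⟩ := Nat.exists_eq_add_of_lt hpos
    rw [zero_add] at *
    rw [min_eq_left h] at h2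
    obtain ⟨k, rfl⟩ := Nat.exists_eq_add_of_le' (hN.trans hNK)
    have key := achievable_maddahAliNiesen (N := N) ht
    have hp0 : (0 : ℝ) < ((k + 1).choose (s + 1) : ℕ) := by
      exact_mod_cast Nat.choose_pos ht
    have e1 : (k.choose s : ℝ) = (k + 1).choose (s + 1) * (s + 1) / (k + 1) := by
      have := Nat.add_one_mul_choose_eq k s
      rw [eq_div_iff (by positivity)]
      have h : ((k : ℝ) + 1) * k.choose s = (k + 1).choose (s + 1) * (s + 1) := by
        exact_mod_cast this
      linarith
    have e2 : ((k + 1).choose (s + 2) : ℝ) = (k + 1).choose (s + 1) * (k - s) / (s + 2) := by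
      have := Nat.choose_succ_right_eq (k + 1) (s + 1)
      rw [eq_div_iff (by positivity)]
      have h := congrArg (Nat.cast (R := ℝ)) this
      rw [show k + 1 - (s + 1) = k - s by omega] at h
      push_cast [Nat.cast_sub (show s ≤ k by omega)] at h
      rw [show (s : ℝ) + 2 = s + 1 + 1 by ring]
      exact h
    rw [h1, h2]
    convert key using 1
    · rw [show k + 1 - 1 = k from rfl]
      push_cast
      rw [e1]
      field_simp
    · rw [e2]
      push_cast
      rw [show (1 : ℝ) + (s + 1) = s + 2 by ring]
      field_simp
      ring
  · rw [h2, min_eq_right h]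
    exact huncoded

theorem corollary1 (N K : ℕ) (hN : 1 ≤ N) (hNK : N ≤ K) (M : ℝ) (hM₀ : 0 ≤ M) (hM : M ≤ N) :
    IsLeast {R : ℝ | (M, R) ∈
        convexHull ℝ (interferenceEliminationPoints N K ∪ maddahAliNiesenPoints N K)}
      (lowerConvexEnvelope (interferenceEliminationPoints N K ∪ maddahAliNiesenPoints N K) M) ∧
    Achievable N K M
      (lowerConvexEnvelope (interferenceEliminationPoints N K ∪ maddahAliNiesenPoints N K) M) := by
  have hNR : (0 : ℝ) < N := by exact_mod_cast hN
  have hKR : (0 : ℝ) < K := by exact_mod_cast hN.trans hNK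
  set P := interferenceEliminationPoints N K ∪ maddahAliNiesenPoints N K with hP
  have hfin : P.Finite :=
    (finite_interferenceEliminationPoints N K).union (finite_maddahAliNiesenPoints N K)
  -- the points of `maddahAliNiesenPoints` with abscissas `0` and `N`
  obtain ⟨R₀, h₀⟩ : ∃ R₀, ((0, R₀) : ℝ × ℝ) ∈ convexHull ℝ P :=
    ⟨K * (1 - 0 / N) * min (1 / (1 + (K : ℝ) * 0 / N)) ((N : ℝ) / K),
      subset_convexHull ℝ P (Or.inr ⟨⟨0, Nat.zero_le K, by simp⟩, rfl⟩)⟩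
  obtain ⟨R₁, h₁⟩ : ∃ R₁, ((N, R₁) : ℝ × ℝ) ∈ convexHull ℝ P :=
    ⟨K * (1 - N / N) * min (1 / (1 + (K : ℝ) * N / N)) ((N : ℝ) / K),
      subset_convexHull ℝ P (Or.inr ⟨⟨K, le_rfl, by field_simp⟩, rfl⟩)⟩
  have hmem := convex_convexHull ℝ P h₀ h₁ (sub_nonneg.2 ((div_le_one hNR).2 hM))
    (div_nonneg hM₀ hNR.le) (sub_add_cancel _ _)
  simp only [Prod.smul_mk, Prod.mk_add_mk, smul_eq_mul, mul_zero, zero_add,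
    div_mul_cancel₀ M hNR.ne'] at hmem
  have hleast := isLeast_lowerConvexEnvelope hfin hmem
  refine ⟨hleast, ?_⟩
  have hsub : convexHull ℝ P ⊆ {p : ℝ × ℝ | Achievable N K p.1 p.2} := by
    refine convexHull_min ?_ (convex_achievable N K)
    rintro p (hp | hp)
    · exact achievable_of_mem_interferenceEliminationPoints hN hNK hp
    · exact achievable_of_mem_maddahAliNiesenPoints hN hNK hp
  exact hsub hleast.1
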